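/- Fix a standard (acceptable) numbering $(\varphi_e)_{e\in\mathbb N}$ of all partial computable functions $\mathbb N\rightharpoonup\mathbb N$ and let $W_e=\operatorname{dom}(\varphi_e)$. Let $\mathcal R$ be the set of total computable functions $\mathbb N\to\mathbb N$. An \emph{$\mathcal R$-monoid} is a set $\mathcal I$ of partial computable functions $\mathbb N\rightharpoonup\mathbb N$ that contains $\mathcal R$ and is closed under composition. A \emph{text} is a total function $T:\mathbb N\to\mathbb N\cup\{\#\}$; its \emph{content} $\operatorname{content}(T)$ is its range without the pause symbol $\#$, and $T[n]=(T(0),\dots,T(n-1))$, with $\operatorname{content}(T[n])$ defined likewise. A text $T$ is a \emph{text of} $L\subseteq\mathbb N$ if $\operatorname{content}(T)=L$; for $\mathcal S\subseteq\mathcal P(\mathbb N)$, let $\mathbf{Txt}(\mathcal S)$ be the set of all texts of elements of $\mathcal S$. A \emph{learner} is a partial computable function $h$. In partially set-driven ($\mathbf{Psd}$) learning, its (possibly partial) sequence of hypotheses on the text $T$ is $p(i)=h(\operatorname{content}(T[i]),i)$, where pairs of a finite set and a number are coded by natural numbers in a standard way; $h$ is \emph{defined} on $T$ if $p$ is total.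 For total $p$ let \begin{itemize} \item $\mathbf{Ex}(p,T)$: there is $n_0$ such that, for all $n\ge n_0$, $p(n)=p(n_0)$ and $W_{p(n_0)}=\operatorname{content}(T)$; \item $\mathbf{Wb}(p,T)$ (witness-based): for all $n,m$, if $p(k)\ne p(n)$ for some $k$ with $n\le k\le m$, then $(\operatorname{content}(T[m])\cap W_{p(m)})\setminus W_{p(n)}\ne\emptyset$; \item $\mathbf{CautTar}(p,T)$ (target-cautious): for no $n$ does $\operatorname{content}(T)\subsetneq W_{p(n)}$ hold. \end{itemize} A learner satisfies such a restriction on $T$ if it is defined on $T$ and its sequence of hypotheses on $T$ satisfies it. For restrictions $\delta,\varepsilon$, a learner $\mathbf{TxtPsd}\,\delta\,\varepsilon$-learns a class $\mathcal L$ of subsets of $\mathbb N$ if it satisfies both $\delta$ and $\varepsilon$ on every text of every $L\in\mathcal L$. \textbf{Theorem.} Let $\mathcal I$ be an $\mathcal R$-monoid, let $\mathcal S\subseteq\mathcal P(\mathbb N)$ be closed under subsets, and let $\mathcal L\subseteq\mathcal P(\mathbb N)$ be a class of sets (languages). Then the following are equivalent. \begin{enumerate} \item Some learner $h\in\mathcal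 I$ $\mathbf{TxtPsd}\,\mathbf{Wb}\,\mathbf{Ex}$-learns $\mathcal L$ and satisfies $\mathbf{Wb}$ also on every text in $\mathbf{Txt}(\mathcal S)$. \item Some learner $h\in\mathcal I$ $\mathbf{TxtPsd}\,\mathbf{CautTar}\,\mathbf{Ex}$-learns $\mathcal L$ and is defined also on every text in $\mathbf{Txt}(\mathcal S)$. \end{enumerate} -/

import Mathlib

namespace InductiveInference

/-- The effective numbering `φ₀, φ₁, …` of all partial computable functions given by
Gödel numbers of programs. -/
def phi (e : ℕ) : ℕ →. ℕ := (Denumerable.ofNat Nat.Partrec.Code e).eval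

/-- The `e`-th computably enumerable set `W e = dom (φ e)`. -/
def W (e : ℕ) : Set ℕ := (phi e).Dom

/-- A text is a total function into `ℕ ∪ {#}`; the pause symbol `#` is `none`. -/
abbrev Text : Type := ℕ → Option ℕ

/-- The content of a text: its range without the pause symbol. -/
def Text.content (T : Text) : Set ℕ := {x | ∃ i, T i = some x}

/-- `T.init n = (T 0, …, T (n - 1))`, the initial sequence of length `n`. -/
def Text.init (T : Text) (n : ℕ) : List (Option ℕ) := (List.range n).map T

/-- The content of a finite sequence. -/
def seqContent (σ : List (Option ℕ)) : Finset ℕ := σ.reduceOption.toFinset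

/-- The texts of the set `L`. -/
def textsOf (L : Set ℕ) : Set Text := {T | T.content = L}

/-- The texts of elements of the class `S`. -/
def textsOfClass (S : Set (Set ℕ)) : Set Text := ⋃ A ∈ S, textsOf A

/-- The partially set-driven sequence interaction function `σ ↦ (content σ, |σ|)`. -/
def psd (σ : List (Option ℕ)) : Finset ℕ × ℕ := (seqContent σ, σ.length)

/-- Coding of a pair (finite set, number) as a number, through the canonical index
`∑ x ∈ D, 2 ^ x` of the finite set `D`. -/
def psdCode (d : Finset ℕ × ℕ) : ℕ := Nat.pair (∑ x ∈ d.1, 2 ^ x) d.2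

/-- The interaction operator `Psd`: the possibly partial sequence of hypotheses of the
learner `h` on the text `T`. -/
def psdOp (h : ℕ →. ℕ) (T : Text) : ℕ →. ℕ := fun i => h (psdCode (psd (T.init i)))

/-- A learning restriction: a predicate on total learning sequences and texts. -/
abbrev Restriction : Type := (ℕ → ℕ) → Text → Prop

/-- A possibly partial sequence of hypotheses meets a restriction if it is total and, as a
total sequence, satisfies the restriction. -/
def Meets (δ : Restriction) (q : ℕ →. ℕ) (T : Text) : Prop :=
  ∃ p : ℕ → ℕ, (∀ i, q i = Part.some (p i)) ∧ δ p T

/-- Explanatory learning. -/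
def Ex : Restriction := fun p T =>
  ∃ n₀, ∀ n, n₀ ≤ n → p n = p n₀ ∧ W (p n₀) = T.content

/-- Witness-based learning. -/
def Wb : Restriction := fun p T =>
  ∀ n m, (∃ k, n ≤ k ∧ k ≤ m ∧ p n ≠ p k) →
    (((seqContent (T.init m) : Set ℕ) ∩ W (p m)) \ W (p n)).Nonempty

/-- Target-cautious learning. -/
def CautTar : Restriction := fun p T => ∀ n, ¬ (T.content ⊂ W (p n))

/-- The absence of a restriction. -/
def NoRestriction : Restriction := fun _ _ => True

/-- The conjunction of two restrictions. -/
def Both (δ ε : Restriction) : Restriction := fun p T => δ p T ∧ ε p T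

/-- The restriction `δ` holds for the `Psd`-learner `h` on every text from `𝒯`. In particular,
`h` is defined on all these texts. -/
def PsdOn (δ : Restriction) (h : ℕ →. ℕ) (𝒯 : Set Text) : Prop :=
  ∀ T ∈ 𝒯, Meets δ (psdOp h T) T

/-- `TxtPsd δ h` is the class of all sets that the learner `h` learns from text in the
partially set-driven way under the restriction `δ`. -/
def TxtPsd (δ : Restriction) (h : ℕ →. ℕ) : Set (Set ℕ) := {L | PsdOn δ h (textsOf L)}

/-- Sets of partial computable functions that are closed under composition and contain all
total computable functions; the identity, being total computable, is the neutral element. -/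
structure IsTotalMonoid (I : Set (ℕ →. ℕ)) : Prop where
  partrec : ∀ f ∈ I, Nat.Partrec f
  comp_mem : ∀ f ∈ I, ∀ g ∈ I, f.comp g ∈ I
  total_mem : ∀ f : ℕ → ℕ, Computable f → (f : ℕ →. ℕ) ∈ I

end InductiveInference

namespace InductiveInference

open Nat.Partrec Encodable Denumerable

/-! From witness-based to target-cautious the same learner works: if a hypothesis properly contained
the target, the final change to the target would need a witness outside that hypothesis
(`Wb.cautTar`). Conversely, a learner with program `c` is turned into a total computable one, hence
an element of the monoid, that is witness-based on every text (`exists_total_wb`).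

Its hypothesis depends only on a cut-off `k` and the part `b` of the content below `k`. The set
`hypSet c b k` contains `b`, no other number below `k`, and above `k` follows the hypothesis of `c`
on `(b, 2 * k)` once that one covers `b`. It stops growing before a stage is doubted, that is, seen
to contain a finite set on which `c` would change its mind. The cut-off moves when the observed
content contains such a set and has not been covered by an undoubted stage. Such content never fits
into the old hypothesis, which yields the witness (`not_subset_hypSet_of_change`). Refutation passes
to supersets, so an abandoned hypothesis does not come back (`not_return`).

On a learned `L`, infinitely many refutations could be spliced into a text of `L` on which `c`
changes its mind infinitely often (`Learns.not_forall_refuted`). A hypothesis that is never refuted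
is correct (`Learns.hypSet_eq`): if it covers `L`, target-caution of `c` excludes surplus elements;
otherwise `c` never changes its mind inside `L`, so its hypothesis is correct and is enumerated in
full, a contradiction. -/

/-- The finite set with canonical index `d`. -/
def bits (d : ℕ) : Set ℕ := {x | d.testBit x = true}

theorem mem_bits {d x : ℕ} : x ∈ bits d ↔ d.testBit x = true := Iff.rfl

/-- The part of `W e` enumerated within `s` steps, where `e` is the hypothesis of `c` on `(b, 2 * k)`,
provided that `e` is found within `s` steps. -/
def enumerated (c : Code) (b k s : ℕ) : Set ℕ :=
  {x | ((Code.evaln s c (Nat.pair b (2 * k))).bind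
    fun e => Code.evaln s (ofNat Code e) x).isSome = true}

/-- The candidate for the set enumerated by the witness-based hypothesis after `s` steps. -/
def stage (c : Code) (b k s : ℕ) : Set ℕ :=
  {x | x ∈ bits b ∨ (k ≤ x ∧ x < s ∧ bits b ⊆ enumerated c b k s ∧ x ∈ enumerated c b k s)}

/-- Within `t` steps, the hypothesis of `c` on `(d, j)` is seen to differ from that on
`(b, 2 * k)`, for some `j` such that `(d, j)` can come after `(b, 2 * k)` in a text. -/
def Conflict (c : Code) (b k d t : ℕ) : Prop :=
  bits b ⊆ bits d ∧ ∃ j < t + 1, 2 * k ≤ j ∧ d < 2 ^ (j - 2 * k) ∧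
    (Code.evaln t c (Nat.pair b (2 * k))).isSome = true ∧
    (Code.evaln t c (Nat.pair d j)).isSome = true ∧
    ¬ Code.evaln t c (Nat.pair b (2 * k)) = Code.evaln t c (Nat.pair d j)

/-- Within `t` steps, a subset of `A` is found that conflicts with the hypothesis on `(b, 2 * k)`. -/
def Doubted (c : Code) (b k : ℕ) (A : Set ℕ) (t : ℕ) : Prop :=
  ∃ d < t + 1, bits d ⊆ A ∧ Conflict c b k d t

/-- The set with index `d` is doubted before it is enumerated. -/
def Refuted (c : Code) (b k d t : ℕ) : Prop :=
  Doubted c b k (bits d) t ∧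
    ∀ s < t + 1, bits d ⊆ stage c b k s → Doubted c b k (stage c b k s) s

/-- The language of the witness-based hypothesis with the parameters `b` and `k`. -/
def hypSet (c : Code) (b k : ℕ) : Set ℕ :=
  {x | ∃ s, x ∈ stage c b k s ∧ ¬ Doubted c b k (stage c b k s) s}

open Classical in
/-- The cut-off point of the current hypothesis after `i` data items with content `d`. -/
noncomputable def cut (c : Code) (d : ℕ) : ℕ → ℕ
  | 0 => 0
  | i + 1 =>
    if Refuted c (d % 2 ^ cut c d i) (cut c d i) (d % 2 ^ (i + 1)) (i + 1) then i + 1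
    else cut c d i

/-! ### Primitive recursiveness of stages, doubts and cut-offs; indices for `hypSet`. -/

section Primrec

variable {α : Type*} [Primcodable α]

theorem primrec_two_pow {f : α → ℕ} (hf : Primrec f) : Primrec fun a => 2 ^ f a := by
  have h : Primrec fun n : ℕ => 2 ^ n := by
    refine (Primrec.nat_rec₁ (f := fun _ m => 2 * m) 1
      (Primrec.nat_mul.comp (Primrec.const 2) Primrec.snd)).of_eq fun n => ?_
    induction n with
    | zero => rfl
    | succ n ih => simp only [ih]; ring
  exact h.comp hf

theorem primrec_mod_two_pow {f g : α → ℕ} (hf : Primrec f) (hg : Primrec g) :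
    Primrec fun a => f a % 2 ^ g a :=
  Primrec.nat_mod.comp hf (primrec_two_pow hg)

theorem primrecPred_exists_lt {P : α → ℕ → Prop} {f : α → ℕ} (hf : Primrec f)
    (hP : PrimrecPred fun p : α × ℕ => P p.1 p.2) : PrimrecPred fun a => ∃ x < f a, P a x := by
  have h : PrimrecRel fun (x : ℕ) (a : α) => P a x := hP.comp (Primrec.snd.pair Primrec.fst)
  exact (h.exists_mem_list.comp (Primrec.list_range.comp hf) Primrec.id).of_eq (by simp)

theorem primrecPred_forall_lt {P : α → ℕ → Prop} {f : α → ℕ} (hf : Primrec f)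
    (hP : PrimrecPred fun p : α × ℕ => P p.1 p.2) : PrimrecPred fun a => ∀ x < f a, P a x := by
  have h : PrimrecRel fun (x : ℕ) (a : α) => P a x := hP.comp (Primrec.snd.pair Primrec.fst)
  exact (h.forall_mem_list.comp (Primrec.list_range.comp hf) Primrec.id).of_eq (by simp)

theorem primrecPred_imp {P Q : α → Prop} (hP : PrimrecPred P) (hQ : PrimrecPred Q) :
    PrimrecPred fun a => P a → Q a :=
  (hP.not.or hQ).of_eq fun _ => imp_iff_not_or.symm

theorem primrecPred_bool {f : α → Bool} (hf : Primrec f) : PrimrecPred fun a => f a = true :=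
  Primrec.eq.comp hf (Primrec.const true)

theorem primrecPred_mem_bits {d x : α → ℕ} (hd : Primrec d) (hx : Primrec x) :
    PrimrecPred fun a => x a ∈ bits (d a) := by
  have h : PrimrecPred fun a => d a / 2 ^ x a % 2 = 1 :=
    Primrec.eq.comp (Primrec.nat_mod.comp (Primrec.nat_div.comp hd (primrec_two_pow hx))
      (Primrec.const 2)) (Primrec.const 1)
  exact h.of_eq fun a => by simp [mem_bits, Nat.testBit_eq_decide_div_mod_eq]

theorem lt_of_mem_bits {d x : ℕ} (h : x ∈ bits d) : x < d :=
  Nat.lt_two_pow_self.trans_le (Nat.ge_two_pow_of_testBit h)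

theorem primrecPred_bits_subset {A : α → Set ℕ} {d : α → ℕ} (hd : Primrec d)
    (hA : PrimrecPred fun p : α × ℕ => p.2 ∈ A p.1) : PrimrecPred fun a => bits (d a) ⊆ A a := by
  have h : PrimrecPred fun a => ∀ x < d a, x ∈ bits (d a) → x ∈ A a :=
    primrecPred_forall_lt hd
      (primrecPred_imp (primrecPred_mem_bits (hd.comp Primrec.fst) Primrec.snd) hA)
  exact h.of_eq fun a => ⟨fun h x hx => h x (lt_of_mem_bits hx) hx, fun h x _ hx => h hx⟩

theorem primrec_evaln_comp {s n : α → ℕ} {e : α → Code} (hs : Primrec s) (he : Primrec e)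
    (hn : Primrec n) : Primrec fun a => Code.evaln (s a) (e a) (n a) :=
  Code.primrec_evaln.comp ((hs.pair he).pair hn)

theorem primrec_evaln_pair (c : Code) {s m n : α → ℕ} (hs : Primrec s) (hm : Primrec m)
    (hn : Primrec n) : Primrec fun a => Code.evaln (s a) c (Nat.pair (m a) (n a)) :=
  primrec_evaln_comp hs (Primrec.const c) (Primrec₂.natPair.comp hm hn)

theorem primrec_two_mul {f : α → ℕ} (hf : Primrec f) : Primrec fun a => 2 * f a :=
  Primrec.nat_mul.comp (Primrec.const 2) hf

theorem primrecPred_mem_enumerated (c : Code) {b k s x : α → ℕ} (hb : Primrec b)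
    (hk : Primrec k) (hs : Primrec s) (hx : Primrec x) :
    PrimrecPred fun a => x a ∈ enumerated c (b a) (k a) (s a) := by
  refine primrecPred_bool (Primrec.option_isSome.comp (Primrec.option_bind
    (primrec_evaln_pair c hs hb (primrec_two_mul hk)) ?_))
  exact primrec_evaln_comp (hs.comp Primrec.fst) ((Primrec.ofNat Code).comp Primrec.snd)
    (hx.comp Primrec.fst)

theorem primrecPred_mem_stage (c : Code) {b k s x : α → ℕ} (hb : Primrec b) (hk : Primrec k)
    (hs : Primrec s) (hx : Primrec x) :
    PrimrecPred fun a => x a ∈ stage c (b a) (k a) (s a) := by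
  refine (primrecPred_mem_bits hb hx).or ((Primrec.nat_le.comp hk hx).and
    ((Primrec.nat_lt.comp hx hs).and (PrimrecPred.and (primrecPred_bits_subset hb ?_)
      (primrecPred_mem_enumerated c hb hk hs hx))))
  exact primrecPred_mem_enumerated c (hb.comp Primrec.fst) (hk.comp Primrec.fst)
    (hs.comp Primrec.fst) Primrec.snd

theorem primrecPred_conflict (c : Code) {b k d t : α → ℕ} (hb : Primrec b) (hk : Primrec k)
    (hd : Primrec d) (ht : Primrec t) :
    PrimrecPred fun a => Conflict c (b a) (k a) (d a) (t a) := by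
  refine PrimrecPred.and (primrecPred_bits_subset hb
    (primrecPred_mem_bits (hd.comp Primrec.fst) Primrec.snd))
    (primrecPred_exists_lt (Primrec.succ.comp ht) ?_)
  have hb' := hb.comp (Primrec.fst (α := α) (β := ℕ))
  have hk' := primrec_two_mul (hk.comp (Primrec.fst (α := α) (β := ℕ)))
  have hd' := hd.comp (Primrec.fst (α := α) (β := ℕ))
  have ht' := ht.comp (Primrec.fst (α := α) (β := ℕ))
  have h₁ := primrec_evaln_pair c ht' hb' hk'
  have h₂ := primrec_evaln_pair c ht' hd' Primrec.snd
  exact (Primrec.nat_le.comp hk' Primrec.snd).and ((Primrec.nat_lt.comp hd'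
    (primrec_two_pow (Primrec.nat_sub.comp Primrec.snd hk'))).and
    ((primrecPred_bool (Primrec.option_isSome.comp h₁)).and
    ((primrecPred_bool (Primrec.option_isSome.comp h₂)).and (Primrec.eq.comp h₁ h₂).not)))

theorem primrecPred_doubted (c : Code) {b k t : α → ℕ} {A : α → Set ℕ} (hb : Primrec b)
    (hk : Primrec k) (ht : Primrec t) (hA : PrimrecPred fun p : α × ℕ => p.2 ∈ A p.1) :
    PrimrecPred fun a => Doubted c (b a) (k a) (A a) (t a) := by
  refine primrecPred_exists_lt (Primrec.succ.comp ht) (PrimrecPred.and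
    (primrecPred_bits_subset Primrec.snd
      (hA.comp ((Primrec.fst.comp Primrec.fst).pair Primrec.snd)))
    (primrecPred_conflict c (hb.comp Primrec.fst) (hk.comp Primrec.fst) Primrec.snd
      (ht.comp Primrec.fst)))

theorem primrecPred_doubted_stage (c : Code) {b k s : α → ℕ} (hb : Primrec b)
    (hk : Primrec k) (hs : Primrec s) :
    PrimrecPred fun a => Doubted c (b a) (k a) (stage c (b a) (k a) (s a)) (s a) :=
  primrecPred_doubted c hb hk hs (primrecPred_mem_stage c (hb.comp Primrec.fst)
    (hk.comp Primrec.fst) (hs.comp Primrec.fst) Primrec.snd)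

theorem primrecPred_refuted (c : Code) {b k d t : α → ℕ} (hb : Primrec b) (hk : Primrec k)
    (hd : Primrec d) (ht : Primrec t) :
    PrimrecPred fun a => Refuted c (b a) (k a) (d a) (t a) := by
  refine (primrecPred_doubted c hb hk ht (primrecPred_mem_bits (hd.comp Primrec.fst)
    Primrec.snd)).and (primrecPred_forall_lt (Primrec.succ.comp ht) (primrecPred_imp ?_ ?_))
  · exact primrecPred_bits_subset (hd.comp Primrec.fst) (primrecPred_mem_stage c
      (hb.comp (Primrec.fst.comp Primrec.fst)) (hk.comp (Primrec.fst.comp Primrec.fst))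
      (Primrec.snd.comp Primrec.fst) Primrec.snd)
  · exact primrecPred_doubted_stage c (hb.comp Primrec.fst) (hk.comp Primrec.fst) Primrec.snd

theorem primrec_cut (c : Code) {d i : α → ℕ} (hd : Primrec d) (hi : Primrec i) :
    Primrec fun a => cut c (d a) (i a) := by
  classical
  have hj : Primrec fun p : α × ℕ × ℕ => p.2.1 + 1 :=
    Primrec.succ.comp (Primrec.fst.comp Primrec.snd)
  have hm : Primrec fun p : α × ℕ × ℕ => p.2.2 := Primrec.snd.comp Primrec.snd
  have hd' : Primrec fun p : α × ℕ × ℕ => d p.1 := hd.comp Primrec.fst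
  refine (Primrec.nat_rec' hi (Primrec.const 0) (h := fun a p =>
    if Refuted c (d a % 2 ^ p.2) p.2 (d a % 2 ^ (p.1 + 1)) (p.1 + 1) then p.1 + 1 else p.2)
    (Primrec.ite (primrecPred_refuted c (primrec_mod_two_pow hd' hm) hm
      (primrec_mod_two_pow hd' hj) hj) hj hm)).of_eq fun a => ?_
  induction i a with
  | zero => rfl
  | succ n ih => simp only [ih, cut]

end Primrec

/-- The sets `hypSet c b k` are uniformly computably enumerable. -/
theorem exists_index_hypSet (c : Code) :
    ∃ q : ℕ → ℕ, Computable q ∧ ∀ b k, W (q (Nat.pair b k)) = hypSet c b k := by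
  classical
  let R : ℕ → ℕ → Prop := fun n s =>
    n.unpair.2 ∈ stage c n.unpair.1.unpair.1 n.unpair.1.unpair.2 s ∧
      ¬ Doubted c n.unpair.1.unpair.1 n.unpair.1.unpair.2
        (stage c n.unpair.1.unpair.1 n.unpair.1.unpair.2 s) s
  have hR : PrimrecPred fun p : ℕ × ℕ => R p.1 p.2 := by
    have h₁ : Primrec fun p : ℕ × ℕ => p.1.unpair := Primrec.unpair.comp Primrec.fst
    have h₂ : Primrec fun p : ℕ × ℕ => p.1.unpair.1.unpair :=
      Primrec.unpair.comp (Primrec.fst.comp h₁)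
    have hb := Primrec.fst.comp h₂
    have hk := Primrec.snd.comp h₂
    exact (primrecPred_mem_stage c hb hk Primrec.snd (Primrec.snd.comp h₁)).and
      (primrecPred_doubted_stage c hb hk Primrec.snd).not
  have hf : Partrec fun n : ℕ => Nat.rfind fun s => Part.some (decide (R n s)) :=
    Partrec.rfind hR.decide.to_comp.partrec
  obtain ⟨e, he⟩ := Code.exists_code.1 (Partrec.nat_iff.1 hf)
  refine ⟨fun n => encode (Code.curry e n), Computable.encode.comp
    (Code.primrec₂_curry.comp (Primrec.const e) Primrec.id).to_comp, fun b k => ?_⟩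
  ext x
  have h : x ∈ W (encode (Code.curry e (Nat.pair b k))) ↔
      (Nat.rfind fun s => Part.some (decide (R (Nat.pair (Nat.pair b k) x) s))).Dom := by
    simp only [W, phi, ofNat_encode, PFun.mem_dom, Code.eval_curry, he, ← Part.dom_iff_mem]
  refine h.trans (Nat.rfind_dom.trans ?_)
  simp [R, hypSet]

/-! ### Finite sets as bit patterns; monotonicity of stages, doubts and refutations. -/

theorem mem_bits_mod {d k x : ℕ} : x ∈ bits (d % 2 ^ k) ↔ x < k ∧ x ∈ bits d := by
  simp [mem_bits, Nat.testBit_mod_two_pow]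

theorem bits_ext {d d' : ℕ} (h : ∀ x, x ∈ bits d ↔ x ∈ bits d') : d = d' :=
  Nat.eq_of_testBit_eq fun x => Bool.eq_iff_iff.2 (h x)

theorem mod_two_pow_congr {d d' k : ℕ} (h : ∀ x < k, x ∈ bits d ↔ x ∈ bits d') :
    d % 2 ^ k = d' % 2 ^ k :=
  bits_ext fun x => by rw [mem_bits_mod, mem_bits_mod]; exact and_congr_right (h x)

theorem mem_bits_congr {d d' k x : ℕ} (h : d % 2 ^ k = d' % 2 ^ k) (hx : x < k) :
    x ∈ bits d ↔ x ∈ bits d' := by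
  have := (mem_bits_mod (d := d) (k := k) (x := x)).symm.trans (by rw [h, mem_bits_mod])
  simpa [hx] using this

theorem bits_mod_mono {d d' : ℕ} (h : bits d ⊆ bits d') {k k' : ℕ} (hk : k ≤ k') :
    bits (d % 2 ^ k) ⊆ bits (d' % 2 ^ k') := fun _ hx =>
  mem_bits_mod.2 ⟨(mem_bits_mod.1 hx).1.trans_le hk, h (mem_bits_mod.1 hx).2⟩

section Monotonicity

variable {c : Code} {b k : ℕ}

theorem evaln_eq_of_isSome {e : Code} {n s t : ℕ} (hst : s ≤ t)
    (h : (Code.evaln s e n).isSome = true) : Code.evaln t e n = Code.evaln s e n := by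
  obtain ⟨v, hv⟩ := Option.isSome_iff_exists.1 h
  rw [hv]
  exact Code.evaln_mono hst hv

theorem mem_enumerated {s x : ℕ} : x ∈ enumerated c b k s ↔
    ∃ e, e ∈ Code.evaln s c (Nat.pair b (2 * k)) ∧
      ∃ v, v ∈ Code.evaln s (ofNat Code e) x := by
  simp [enumerated, Option.isSome_iff_exists, Option.bind_eq_some_iff]
  tauto

theorem enumerated_mono {s t : ℕ} (hst : s ≤ t) : enumerated c b k s ⊆ enumerated c b k t := by
  intro x hx
  obtain ⟨e, he, v, hv⟩ := mem_enumerated.1 hx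
  exact mem_enumerated.2 ⟨e, Code.evaln_mono hst he, v, Code.evaln_mono hst hv⟩

theorem stage_mono {s t : ℕ} (hst : s ≤ t) : stage c b k s ⊆ stage c b k t := by
  rintro x (hx | ⟨h₁, h₂, h₃, h₄⟩)
  · exact Or.inl hx
  · exact Or.inr ⟨h₁, h₂.trans_le hst, h₃.trans (enumerated_mono hst), enumerated_mono hst h₄⟩

theorem bits_subset_stage (s : ℕ) : bits b ⊆ stage c b k s := fun _ => Or.inl

theorem Conflict.mono {d s t : ℕ} (hst : s ≤ t) (h : Conflict c b k d s) :
    Conflict c b k d t := by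
  obtain ⟨hb, j, hj, h₁, h₂, h₃, h₄, h₅⟩ := h
  refine ⟨hb, j, by omega, h₁, h₂, ?_⟩
  rw [evaln_eq_of_isSome hst h₃, evaln_eq_of_isSome hst h₄]
  exact ⟨h₃, h₄, h₅⟩

theorem Doubted.mono {A B : Set ℕ} {s t : ℕ} (hAB : A ⊆ B) (hst : s ≤ t)
    (h : Doubted c b k A s) : Doubted c b k B t := by
  obtain ⟨d, hd, hdA, hc⟩ := h
  exact ⟨d, by omega, hdA.trans hAB, hc.mono hst⟩

/-- A larger set contains the same conflicting subset and is covered by fewer stages. This lets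
refutations be transferred along growing content. -/
theorem Refuted.mono {d d' t : ℕ} (hd : bits d ⊆ bits d') (h : Refuted c b k d t) :
    Refuted c b k d' t :=
  ⟨h.1.mono hd le_rfl, fun s hs h' => h.2 s hs (hd.trans h')⟩

/-- `Code.evaln 0` halts nowhere. Hence stage 0, which is just `bits b`, is always accepted into the
hypothesis. -/
theorem not_doubted_zero (A : Set ℕ) : ¬ Doubted c b k A 0 := by
  rintro ⟨d, -, -, -, j, -, -, -, h, -⟩
  simp [Code.evaln] at h

theorem bits_subset_hypSet : bits b ⊆ hypSet c b k := fun _ hx =>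
  ⟨0, bits_subset_stage 0 hx, not_doubted_zero _⟩

/-- Stages only add numbers from `k` on. Thus any later datum below `k` is a witness against the
hypothesis. -/
theorem mem_bits_of_mem_hypSet {x : ℕ} (hx : x ∈ hypSet c b k) (hxk : x < k) : x ∈ bits b := by
  obtain ⟨s, h | h, -⟩ := hx
  · exact h
  · omega

/-- Stages increase, so the later of two undoubted stages serves for both; `bits d` is finite. -/
theorem exists_stage_of_subset_hypSet {d : ℕ} (h : bits d ⊆ hypSet c b k) :
    ∃ s, bits d ⊆ stage c b k s ∧ ¬ Doubted c b k (stage c b k s) s := by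
  have key : ∀ n, ∃ s, (∀ x < n, x ∈ bits d → x ∈ stage c b k s) ∧
      ¬ Doubted c b k (stage c b k s) s := by
    intro n
    induction n with
    | zero => exact ⟨0, by simp, not_doubted_zero _⟩
    | succ n ih =>
      obtain ⟨s, hs, hs'⟩ := ih
      by_cases hn : n ∈ bits d
      · obtain ⟨t, ht, ht'⟩ := h hn
        rcases le_total s t with hst | hst
        · refine ⟨t, fun x hx hxd => ?_, ht'⟩
          rcases Nat.lt_succ_iff_lt_or_eq.1 hx with hx | rfl
          · exact stage_mono hst (hs x hx hxd)
          · exact ht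
        · refine ⟨s, fun x hx hxd => ?_, hs'⟩
          rcases Nat.lt_succ_iff_lt_or_eq.1 hx with hx | rfl
          · exact hs x hx hxd
          · exact stage_mono hst ht
      · refine ⟨s, fun x hx hxd => ?_, hs'⟩
        rcases Nat.lt_succ_iff_lt_or_eq.1 hx with hx | rfl
        · exact hs x hx hxd
        · exact absurd hxd hn
  obtain ⟨s, hs, hs'⟩ := key d
  exact ⟨s, fun x hx => hs x (lt_of_mem_bits hx) hx, hs'⟩

/-- A refuted set is never enumerated by the hypothesis that it refutes. -/
theorem Refuted.not_subset_hypSet {d t : ℕ} (h : Refuted c b k d t) :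
    ¬ bits d ⊆ hypSet c b k := by
  intro hd
  obtain ⟨s, hs, hs'⟩ := exists_stage_of_subset_hypSet hd
  -- A covering stage up to `t` is doubted by the second clause of `Refuted`; a later one inherits
  -- the doubt about `bits d`.
  rcases le_total s t with hst | hst
  · exact hs' (h.2 s (by omega) hs)
  · exact hs' (h.1.mono hs hst)

end Monotonicity

/-! ### Dynamics of the cut-off as content grows. -/

section Cut

variable {c : Code}

theorem cut_le (d i : ℕ) : cut c d i ≤ i := by
  induction i with
  | zero => simp [cut]
  | succ n ih => rw [cut]; split_ifs <;> omega

theorem cut_monotone (d : ℕ) : Monotone (cut c d) := by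
  refine monotone_nat_of_le_succ fun i => ?_
  have := cut_le (c := c) d i
  conv_rhs => rw [cut]
  split_ifs <;> omega

theorem cut_congr {d d' : ℕ} {i : ℕ} (h : ∀ x < i, x ∈ bits d ↔ x ∈ bits d') :
    cut c d i = cut c d' i := by
  induction i with
  | zero => rfl
  | succ n ih =>
    have ih := ih fun x hx => h x (by omega)
    have hn := cut_le (c := c) d' n
    rw [cut, cut, ih, mod_two_pow_congr h,
      mod_two_pow_congr (k := cut c d' n) fun x hx => h x (by omega)]

/-- A cut-off, when it changes, is set to the very index at which the change occurs. -/
theorem cut_cut (d i : ℕ) : cut c d (cut c d i) = cut c d i := by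
  induction i with
  | zero => rfl
  | succ n ih =>
    by_cases h : Refuted c (d % 2 ^ cut c d n) (cut c d n) (d % 2 ^ (n + 1)) (n + 1)
    · have : cut c d (n + 1) = n + 1 := by rw [cut, if_pos h]
      rw [this, this]
    · have : cut c d (n + 1) = cut c d n := by rw [cut, if_neg h]
      rw [this, ih]

theorem cut_eq_of_not_refuted {d k i : ℕ} (hki : k ≤ i) (hk : cut c d k = k)
    (h : ∀ t, k < t → t ≤ i → ¬ Refuted c (d % 2 ^ k) k (d % 2 ^ t) t) : cut c d i = k := by
  induction i, hki using Nat.le_induction with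
  | base => exact hk
  | succ n hn ih =>
    have ih := ih fun t h₁ h₂ => h t h₁ (by omega)
    rw [cut, ih, if_neg (h (n + 1) (by omega) le_rfl)]

theorem not_refuted_of_cut_eq {d k i t : ℕ} (hi : cut c d i = k) (hkt : k < t) (hti : t ≤ i) :
    ¬ Refuted c (d % 2 ^ k) k (d % 2 ^ t) t := by
  intro h
  obtain ⟨n, rfl⟩ : ∃ n, t = n + 1 := ⟨t - 1, by omega⟩
  have hk : cut c d k = k := by rw [← hi, cut_cut]
  have h₁ : cut c d n = k :=
    le_antisymm (hi ▸ cut_monotone d (by omega)) (hk ▸ cut_monotone d (by omega))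
  have h₂ : cut c d (n + 1) = n + 1 := by rw [cut, h₁, if_pos h]
  have := cut_monotone (c := c) d hti
  omega

theorem exists_refuted_of_cut_ne {d k i : ℕ} (hki : k ≤ i) (hk : cut c d k = k)
    (hi : cut c d i ≠ k) :
    ∃ t, k < t ∧ t ≤ cut c d i ∧ Refuted c (d % 2 ^ k) k (d % 2 ^ t) t := by
  by_contra! h
  have hle : k ≤ cut c d i := hk ▸ cut_monotone d hki
  exact hi (cut_cut (c := c) d i ▸ cut_eq_of_not_refuted hle hk h)

theorem not_subset_hypSet_of_change {d₁ d₂ i₁ i₂ : ℕ} (hd : bits d₁ ⊆ bits d₂) (hi : i₁ ≤ i₂)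
    (hne : d₂ % 2 ^ cut c d₂ i₂ = d₁ % 2 ^ cut c d₁ i₁ → cut c d₂ i₂ ≠ cut c d₁ i₁) :
    ¬ bits (d₂ % 2 ^ cut c d₂ i₂) ⊆ hypSet c (d₁ % 2 ^ cut c d₁ i₁) (cut c d₁ i₁) := by
  intro hsub
  have hk₁ := cut_cut (c := c) d₁ i₁
  have hk₂ := cut_cut (c := c) d₂ i₂
  have hle₁ := cut_le (c := c) d₁ i₁
  generalize hk₁' : cut c d₁ i₁ = k₁ at *
  generalize hk₂' : cut c d₂ i₂ = k₂ at *
  -- With equal content below `k₁`, the run on `d₂` passes through the cut-off `k₁` and leaves it by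
  -- a refutation using only data below `k₂`.
  by_cases hb : d₂ % 2 ^ k₁ = d₁ % 2 ^ k₁
  · have hk : cut c d₂ k₁ = k₁ := (cut_congr fun x hx => mem_bits_congr hb hx).trans hk₁
    have hne' : cut c d₂ i₂ ≠ k₁ := by
      rw [hk₂']
      rintro rfl
      exact hne hb rfl
    obtain ⟨t, -, ht, h⟩ := exists_refuted_of_cut_ne (hle₁.trans hi) hk hne'
    rw [hb] at h
    exact h.not_subset_hypSet ((bits_mod_mono subset_rfl (hk₂' ▸ ht)).trans hsub)
  -- New data below `k₁` are not in the old hypothesis, so they must all be at least `k₂`. Then both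
  -- contents agree below `k₂`, and the refutation that moved `d₁` past `k₂` would also have moved
  -- `d₂`.
  · obtain ⟨x, hx, hx₂, hx₁⟩ : ∃ x < k₁, x ∈ bits d₂ ∧ x ∉ bits d₁ := by
      by_contra! h
      exact hb (mod_two_pow_congr fun x hx => ⟨h x hx, fun h' => hd h'⟩)
    have hlt : ∀ y < k₁, y ∈ bits d₂ → y ∉ bits d₁ → k₂ ≤ y := by
      intro y hy hy₂ hy₁
      by_contra! hlt
      exact hy₁ (mem_bits_mod.1
        (mem_bits_of_mem_hypSet (hsub (mem_bits_mod.2 ⟨hlt, hy₂⟩)) hy)).2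
    have hk : k₂ ≤ x := hlt x hx hx₂ hx₁
    have hcongr : ∀ y < k₂, y ∈ bits d₁ ↔ y ∈ bits d₂ := fun y hy => ⟨fun h => hd h, fun h => by
      by_contra h'
      have := hlt y (by omega) h h'
      omega⟩
    obtain ⟨t, ht, ht', h⟩ := exists_refuted_of_cut_ne (c := c) (d := d₁) (k := k₂) (i := i₁)
      (by omega) ((cut_congr hcongr).trans hk₂) (by omega)
    rw [mod_two_pow_congr hcongr] at h
    exact not_refuted_of_cut_eq hk₂' ht (by omega) (h.mono (bits_mod_mono hd le_rfl))

/-- A refutation that removes the cut-off `k` on `d₂` persists on the larger `d₃`, where `k` could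
then not be current. -/
theorem not_return {d₁ d₂ d₃ i₁ i₂ i₃ k : ℕ} (h₁₂ : bits d₁ ⊆ bits d₂) (h₂₃ : bits d₂ ⊆ bits d₃)
    (hi₁₂ : i₁ ≤ i₂) (hi₂₃ : i₂ ≤ i₃) (hk₁ : cut c d₁ i₁ = k) (hk₃ : cut c d₃ i₃ = k)
    (hb : d₁ % 2 ^ k = d₃ % 2 ^ k) : cut c d₂ i₂ = k ∧ d₂ % 2 ^ k = d₁ % 2 ^ k := by
  have hb₂ : d₂ % 2 ^ k = d₁ % 2 ^ k := mod_two_pow_congr fun x hx =>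
    ⟨fun h => (mem_bits_congr hb hx).2 (h₂₃ h), fun h => h₁₂ h⟩
  refine ⟨?_, hb₂⟩
  have hle := cut_le (c := c) d₁ i₁
  by_contra hne
  obtain ⟨t, ht, ht', h⟩ := exists_refuted_of_cut_ne (c := c) (d := d₂) (k := k) (i := i₂)
    (by omega) ((cut_congr fun x hx => mem_bits_congr hb₂ hx).trans
      (by rw [← hk₁, cut_cut])) hne
  rw [hb₂, hb] at h
  exact not_refuted_of_cut_eq hk₃ ht (by have := cut_le (c := c) d₂ i₂; omega)
    (h.mono (bits_mod_mono h₂₃ le_rfl))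

end Cut

/-! ### Texts with prescribed initial contents; truncations of a language. -/

/-- The canonical index of the content of the first `n` items of a text. -/
def Text.code (T : Text) (n : ℕ) : ℕ := ∑ x ∈ seqContent (T.init n), 2 ^ x

theorem mem_bits_sum {D : Finset ℕ} {x : ℕ} : x ∈ bits (∑ y ∈ D, 2 ^ y) ↔ x ∈ D := by
  rw [mem_bits, ← Nat.mem_bitIndices, ← List.mem_toFinset,
    Finset.toFinset_bitIndices_sum_two_pow]

theorem mem_seqContent_init {T : Text} {n x : ℕ} :
    x ∈ seqContent (T.init n) ↔ ∃ i < n, T i = some x := by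
  simp [seqContent, Text.init, List.reduceOption_mem_iff]

theorem mem_bits_code {T : Text} {n x : ℕ} : x ∈ bits (T.code n) ↔ ∃ i < n, T i = some x :=
  mem_bits_sum.trans mem_seqContent_init

theorem bits_code_eq (T : Text) (n : ℕ) : bits (T.code n) = ↑(seqContent (T.init n)) :=
  Set.ext fun _ => mem_bits_sum

theorem bits_code_mono (T : Text) {m n : ℕ} (h : m ≤ n) : bits (T.code m) ⊆ bits (T.code n) := by
  intro x hx
  obtain ⟨i, hi, hx⟩ := mem_bits_code.1 hx
  exact mem_bits_code.2 ⟨i, by omega, hx⟩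

theorem psdCode_init (T : Text) (n : ℕ) : psdCode (psd (T.init n)) = Nat.pair (T.code n) n := by
  simp [psdCode, psd, Text.code, Text.init]

/-- The parameters `(b, k)` of the hypothesis of the witness-based learner, as a code. -/
noncomputable def state (c : Code) (d i : ℕ) : ℕ := Nat.pair (d % 2 ^ cut c d i) (cut c d i)

/-- The witness is found in the base set of the later hypothesis, which lies both in the observed
content and in that hypothesis. -/
theorem wb_of_state {c : Code} {q : ℕ → ℕ} (hq : ∀ b k, W (q (Nat.pair b k)) = hypSet c b k)
    (T : Text) : Wb (fun i => q (state c (T.code i) i)) T := by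
  rintro n m ⟨l, hnl, hlm, hne⟩
  simp only [state, hq] at hne ⊢
  rw [← bits_code_eq]
  have key : ¬ bits (T.code m % 2 ^ cut c (T.code m) m) ⊆
      hypSet c (T.code n % 2 ^ cut c (T.code n) n) (cut c (T.code n) n) := by
    refine not_subset_hypSet_of_change (bits_code_mono T (hnl.trans hlm)) (hnl.trans hlm)
      fun hb hk => hne ?_
    obtain ⟨h₁, h₂⟩ := not_return (bits_code_mono T hnl) (bits_code_mono T hlm) hnl hlm rfl hk
      (by rw [← hb, hk])
    rw [h₁, h₂]
  obtain ⟨x, hx, hx'⟩ := Set.not_subset.1 key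
  exact ⟨x, ⟨(mem_bits_mod.1 hx).2, bits_subset_hypSet hx⟩, hx'⟩

theorem lt_of_mem_bits_of_lt {d n x : ℕ} (hx : x ∈ bits d) (hd : d < 2 ^ n) : x < n :=
  (Nat.pow_lt_pow_iff_right (by norm_num)).1 ((Nat.ge_two_pow_of_testBit hx).trans_lt hd)

/-- There is a text whose content after `n i` items is the prescribed finite set `F i`. -/
theorem exists_text {F n : ℕ → ℕ} (hF₀ : F 0 = 0) (hn : Monotone n)
    (hF : ∀ i, bits (F i) ⊆ bits (F (i + 1))) (hlt : ∀ i, F (i + 1) < 2 ^ (n (i + 1) - n i)) :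
    ∃ T : Text, T.content = ⋃ i, bits (F i) ∧ ∀ i, T.code (n i) = F i := by
  classical
  have hmono : ∀ i j, i ≤ j → bits (F i) ⊆ bits (F j) := fun i j h =>
    monotone_nat_of_le_succ (f := fun i => bits (F i)) hF h
  -- The block from `n i` to `n (i + 1)` lists `F (i + 1)`, with `x` at position `n i + x`; `hlt`
  -- makes it fit.
  let T : Text := fun m =>
    if h : ∃ i, n i ≤ m ∧ m < n (i + 1) ∧ m - n i ∈ bits (F (i + 1)) then some (m - n h.choose)
    else none
  have hT : ∀ m x, T m = some x ↔ ∃ i, m = n i + x ∧ m < n (i + 1) ∧ x ∈ bits (F (i + 1)) := by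
    intro m x
    by_cases h : ∃ i, n i ≤ m ∧ m < n (i + 1) ∧ m - n i ∈ bits (F (i + 1))
    · simp only [T, dif_pos h, Option.some.injEq]
      obtain ⟨h₁, h₂, h₃⟩ := h.choose_spec
      refine ⟨fun hx => ⟨h.choose, by omega, h₂, hx ▸ h₃⟩, ?_⟩
      rintro ⟨j, h₄, h₅, -⟩
      have : h.choose = j := by
        rcases lt_trichotomy h.choose j with hlt | heq | hlt
        · have := hn (show h.choose + 1 ≤ j from hlt)
          omega
        · exact heq
        · have := hn (show j + 1 ≤ h.choose from hlt)
          omega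
      rw [this]
      omega
    · simp only [T, dif_neg h, reduceCtorEq, false_iff]
      rintro ⟨i, rfl, h₂, h₃⟩
      exact h ⟨i, by omega, h₂, by simpa using h₃⟩
  have hmem : ∀ i x, x ∈ bits (F (i + 1)) → n i + x < n (i + 1) ∧ T (n i + x) = some x := by
    intro i x hx
    have := lt_of_mem_bits_of_lt hx (hlt i)
    exact ⟨by omega, (hT _ _).2 ⟨i, rfl, by omega, hx⟩⟩
  refine ⟨T, ?_, fun i => bits_ext fun x => ?_⟩
  · ext x
    simp only [Text.content, Set.mem_ofPred_eq, Set.mem_iUnion]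
    constructor
    · rintro ⟨m, hm⟩
      obtain ⟨i, -, -, hx⟩ := (hT _ _).1 hm
      exact ⟨i + 1, hx⟩
    · rintro ⟨i, hx⟩
      exact ⟨_, (hmem i x (hF i hx)).2⟩
  · rw [mem_bits_code]
    constructor
    · rintro ⟨m, hm, hx⟩
      obtain ⟨j, h₁, -, h₃⟩ := (hT _ _).1 hx
      refine hmono (j + 1) i ?_ h₃
      by_contra! h
      have := hn (show i ≤ j by omega)
      omega
    · intro hx
      cases i with
      | zero => simp [hF₀, mem_bits] at hx
      | succ i => exact ⟨_, (hmem i x hx).1, (hmem i x hx).2⟩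

open Classical in
/-- The canonical index of the set of elements of `L` below `k`. -/
noncomputable def trunc (L : Set ℕ) (k : ℕ) : ℕ := ∑ x ∈ (Finset.range k).filter (· ∈ L), 2 ^ x

theorem mem_bits_trunc {L : Set ℕ} {k x : ℕ} : x ∈ bits (trunc L k) ↔ x < k ∧ x ∈ L := by
  rw [trunc, mem_bits_sum]
  simp

theorem bits_trunc_subset (L : Set ℕ) (k : ℕ) : bits (trunc L k) ⊆ L := fun _ hx =>
  (mem_bits_trunc.1 hx).2

theorem trunc_zero (L : Set ℕ) : trunc L 0 = 0 := by simp [trunc]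

theorem trunc_mod (L : Set ℕ) {k t : ℕ} (h : k ≤ t) : trunc L t % 2 ^ k = trunc L k :=
  bits_ext fun x => by
    rw [mem_bits_mod, mem_bits_trunc, mem_bits_trunc, ← and_assoc]
    exact and_congr_left fun _ => by omega

theorem trunc_lt (L : Set ℕ) (k : ℕ) : trunc L k < 2 ^ k := by
  rw [← trunc_mod L le_rfl]
  exact Nat.mod_lt _ (by positivity)

theorem bits_trunc_mono (L : Set ℕ) {k t : ℕ} (h : k ≤ t) :
    bits (trunc L k) ⊆ bits (trunc L t) := fun _ hx =>
  mem_bits_trunc.2 ⟨(mem_bits_trunc.1 hx).1.trans_le h, (mem_bits_trunc.1 hx).2⟩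

/-! ### Convergence to a correct hypothesis on learned sets. -/

/-- On each text of `L`, the learner `c` is defined, target-cautious and explanatory. -/
def Learns (c : Code) (L : Set ℕ) : Prop :=
  ∀ T : Text, T.content = L → ∃ p : ℕ → ℕ,
    (∀ i, p i ∈ c.eval (Nat.pair (T.code i) i)) ∧ CautTar p T ∧ Ex p T

section Convergence

variable {c : Code} {L : Set ℕ}

/-- By `Refuted.mono`, content inside `L` can refute only what the corresponding truncation of `L`
refutes. -/
theorem cut_trunc_eq {k t : ℕ} (hkt : k ≤ t) (hk : cut c (trunc L k) k = k) {d : ℕ}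
    (hd : d % 2 ^ k = trunc L k) (hdL : bits d ⊆ L)
    (h : ∀ s, k < s → s ≤ t → ¬ Refuted c (trunc L k) k (trunc L s) s) : cut c d t = k := by
  refine cut_eq_of_not_refuted hkt ?_ fun s hs hst h' => ?_
  · refine (cut_congr fun x hx => mem_bits_congr ?_ hx).trans hk
    rw [hd, trunc_mod L le_rfl]
  · rw [hd] at h'
    refine h s hs hst (h'.mono fun x hx => ?_)
    obtain ⟨h₁, h₂⟩ := mem_bits_mod.1 hx
    exact mem_bits_trunc.2 ⟨h₁, hdL h₂⟩

theorem Learns.not_forall_refuted (hL : Learns c L) {K : ℕ → ℕ} (hK₀ : K 0 = 0)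
    (hK : ∀ s, K s < K (s + 1) ∧
      Refuted c (trunc L (K s)) (K s) (trunc L (K (s + 1))) (K (s + 1))) : False := by
  have hge : ∀ s, s ≤ K s := by
    intro s
    induction s with
    | zero => omega
    | succ s ih => have := (hK s).1; omega
  have hwit : ∀ s, ∃ d j, bits d ⊆ bits (trunc L (K (s + 1))) ∧ bits (trunc L (K s)) ⊆ bits d ∧
      j ≤ K (s + 1) ∧ 2 * K s ≤ j ∧ d < 2 ^ (j - 2 * K s) ∧
      ∀ u ∈ c.eval (Nat.pair (trunc L (K s)) (2 * K s)), ∀ v ∈ c.eval (Nat.pair d j), u ≠ v := by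
    intro s
    obtain ⟨⟨d, hd, hdA, hb, j, hj, hj', hlt, h₁, h₂, h₃⟩, -⟩ := (hK s).2
    refine ⟨d, j, hdA, hb, by omega, hj', hlt, ?_⟩
    obtain ⟨u', hu'⟩ := Option.isSome_iff_exists.1 h₁
    obtain ⟨v', hv'⟩ := Option.isSome_iff_exists.1 h₂
    rintro u hu v hv rfl
    rw [hu', hv'] at h₃
    exact h₃ (congrArg some ((Part.mem_unique (Code.evaln_sound hu') hu).trans
      (Part.mem_unique (Code.evaln_sound hv') hv).symm))
  choose D J hD hD' hJ hJ' hlt hne using hwit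
  let F : ℕ → ℕ := fun m => if m % 2 = 0 then trunc L (K (m / 2)) else D (m / 2)
  -- The factor 2 makes room: the conflict occurs at `J s ≤ K (s + 1)`, which leaves at least `K (s
  -- + 1)` positions before `2 * K (s + 1)` to list the next truncation.
  let n : ℕ → ℕ := fun m => if m % 2 = 0 then 2 * K (m / 2) else J (m / 2)
  have hFe : ∀ s, F (2 * s) = trunc L (K s) := fun s => by simp [F]
  have hFo : ∀ s, F (2 * s + 1) = D s := fun s => by
    simp [F, show (2 * s + 1) / 2 = s by omega]
  have hne' : ∀ s, n (2 * s) = 2 * K s := fun s => by simp [n]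
  have hno : ∀ s, n (2 * s + 1) = J s := fun s => by
    simp [n, show (2 * s + 1) / 2 = s by omega]
  have hsucc : ∀ s, 2 * s + 1 + 1 = 2 * (s + 1) := fun s => by ring
  obtain ⟨T, hT, hcode⟩ := exists_text (F := F) (n := n) (by simpa [hK₀, trunc_zero] using hFe 0)
    (monotone_nat_of_le_succ fun i => by
      rcases Nat.even_or_odd' i with ⟨s, rfl | rfl⟩
      · rw [hne', hno]; exact hJ' s
      · rw [hsucc, hne', hno]; have := hJ s; omega)
    (fun i => by
      rcases Nat.even_or_odd' i with ⟨s, rfl | rfl⟩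
      · rw [hFe, hFo]; exact hD' s
      · rw [hsucc, hFe, hFo]; exact hD s)
    (fun i => by
      rcases Nat.even_or_odd' i with ⟨s, rfl | rfl⟩
      · rw [hne', hno, hFo]; exact hlt s
      · rw [hsucc, hne', hno, hFe]
        have := hJ s
        exact (trunc_lt L _).trans_le (Nat.pow_le_pow_right (by norm_num) (by omega)))
  have hTL : T.content = L := by
    rw [hT]
    refine Set.Subset.antisymm (Set.iUnion_subset fun i => ?_) fun x hx => Set.mem_iUnion.2 ?_
    · rcases Nat.even_or_odd' i with ⟨s, rfl | rfl⟩
      · rw [hFe]; exact bits_trunc_subset _ _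
      · rw [hFo]; exact (hD s).trans (bits_trunc_subset _ _)
    · refine ⟨2 * (x + 1), ?_⟩
      rw [hFe]
      exact mem_bits_trunc.2 ⟨hge (x + 1), hx⟩
  obtain ⟨p, hp, -, n₀, hn₀⟩ := hL T hTL
  have h₁ := hp (n (2 * n₀))
  have h₂ := hp (n (2 * n₀ + 1))
  rw [hcode, hne', hFe] at h₁
  rw [hcode, hno, hFo] at h₂
  have := hge n₀
  have := hJ' n₀
  exact hne n₀ _ h₁ _ h₂ ((hn₀ _ (by omega)).1.trans (hn₀ _ (by omega)).1.symm)

/-- On a learned set, the sequence of cut-off points is finite. -/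
theorem Learns.exists_cut (hL : Learns c L) : ∃ k, cut c (trunc L k) k = k ∧
    ∀ t, k < t → ¬ Refuted c (trunc L k) k (trunc L t) t := by
  classical
  by_contra! hcon
  have step : ∀ k, ∃ k', cut c (trunc L k) k = k → cut c (trunc L k') k' = k' ∧
      k < k' ∧ Refuted c (trunc L k) k (trunc L k') k' := by
    intro k
    by_cases hk : cut c (trunc L k) k = k
    swap
    · exact ⟨0, fun h => absurd h hk⟩
    have hex := hcon k hk
    obtain ⟨hkt, ht⟩ := Nat.find_spec hex
    have hmin := fun s (hs : s < Nat.find hex) => Nat.find_min hex hs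
    generalize Nat.find hex = t at hkt ht hmin
    refine ⟨t, fun _ => ⟨?_, hkt, ht⟩⟩
    obtain ⟨n, rfl⟩ : ∃ n, t = n + 1 := ⟨t - 1, by omega⟩
    -- Minimality of the refutation time keeps the cut-off at `k` until then, so it jumps exactly to
    -- `n + 1`.
    have hn : cut c (trunc L (n + 1)) n = k :=
      cut_trunc_eq (by omega) hk (trunc_mod L (by omega)) (bits_trunc_subset _ _)
        fun s hs hsn h' => hmin s (by omega) ⟨hs, h'⟩
    rw [cut, hn, trunc_mod L hkt.le, trunc_mod L le_rfl, if_pos ht]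
  choose next hnext using step
  have hcut : ∀ s, cut c (trunc L (next^[s] 0)) (next^[s] 0) = next^[s] 0 := by
    intro s
    induction s with
    | zero => rfl
    | succ s ih =>
      rw [Function.iterate_succ_apply']
      exact (hnext _ ih).1
  refine hL.not_forall_refuted (K := fun s => next^[s] 0) rfl fun s => ?_
  simp only [Function.iterate_succ_apply']
  exact (hnext _ (hcut s)).2

theorem mem_W_of_mem_evaln {s e x v : ℕ} (h : v ∈ Code.evaln s (ofNat Code e) x) : x ∈ W e :=
  Part.dom_iff_mem.2 ⟨v, Code.evaln_sound h⟩

/-- The unrefuted hypothesis on a learned set `L` is a hypothesis for `L`. -/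
theorem Learns.hypSet_eq (hL : Learns c L) {k : ℕ}
    (hk : ∀ t, k < t → ¬ Refuted c (trunc L k) k (trunc L t) t) : hypSet c (trunc L k) k = L := by
  let F : ℕ → ℕ := fun i => if i = 0 then 0 else trunc L (k + (i - 1))
  -- Successive gaps leave room to list the next truncation. For `i ≥ 1` the distance `i * (k + i)`
  -- from `2 * k` is at least `k + i`, as `Conflict` requires for `trunc L (k + i)`.
  let n : ℕ → ℕ := fun i => if i = 0 then 0 else 2 * k + (i - 1) * (k + (i - 1))
  have hFs : ∀ i, F (i + 1) = trunc L (k + i) := fun i => by simp [F]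
  have hns : ∀ i, n (i + 1) = 2 * k + i * (k + i) := fun i => by simp [n]
  obtain ⟨T, hT, hcode⟩ := exists_text (F := F) (n := n) rfl
    (monotone_nat_of_le_succ fun i => by
      cases i with
      | zero => simp [n]
      | succ i => rw [hns, hns]; nlinarith)
    (fun i => by
      cases i with
      | zero => simp [F, bits]
      | succ i => rw [hFs, hFs]; exact bits_trunc_mono L (by omega))
    (fun i => (hFs i ▸ trunc_lt L (k + i)).trans_le (Nat.pow_le_pow_right (by norm_num) (by
      cases i with
      | zero => rw [hns]; simp [n]; omega
      | succ i =>
        rw [hns, hns]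
        refine Nat.le_sub_of_add_le ?_
        nlinarith)))
  have hTL : T.content = L := by
    rw [hT]
    refine Set.Subset.antisymm (Set.iUnion_subset fun i => ?_) fun x hx => Set.mem_iUnion.2 ?_
    · cases i with
      | zero => simp [F, bits]
      | succ i => rw [hFs]; exact bits_trunc_subset _ _
    · exact ⟨x + 1 + 1, hFs (x + 1) ▸ mem_bits_trunc.2 ⟨by omega, hx⟩⟩
  obtain ⟨p, hp, hcaut, n₀, hn₀⟩ := hL T hTL
  rw [CautTar, hTL] at hcaut
  have hpn : ∀ i, p (2 * k + i * (k + i)) ∈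
      c.eval (Nat.pair (trunc L (k + i)) (2 * k + i * (k + i))) := fun i => by
    have := hp (n (i + 1))
    rwa [hcode, hns, hFs] at this
  have he := hpn 0
  simp only [zero_mul, add_zero] at he
  have hcaut := hcaut (2 * k)
  generalize p (2 * k) = e at he hcaut
  have henum : ∀ s, enumerated c (trunc L k) k s ⊆ W e := by
    intro s x hx
    obtain ⟨e', he', v, hv⟩ := mem_enumerated.1 hx
    obtain rfl := Part.mem_unique (Code.evaln_sound he') he
    exact mem_W_of_mem_evaln hv
  by_cases hsub : L ⊆ hypSet c (trunc L k) k
  · refine (hsub.antisymm fun x hx => ?_).symm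
    by_contra hxL
    obtain ⟨s, h | ⟨-, -, hb, hxe⟩, -⟩ := hx
    · exact hxL (bits_trunc_subset _ _ h)
    -- A surplus element is added only after `W e` covers the base, so `W e` would properly contain
    -- `L`.
    · refine hcaut ⟨fun y hy => ?_, fun h => hxL (h (henum s hxe))⟩
      obtain ⟨s', h | ⟨-, -, -, hye⟩, -⟩ := hsub hy
      · exact henum s (hb h)
      · exact henum s' hye
  · exfalso
    obtain ⟨x, hxL, hx⟩ := Set.not_subset.1 hsub
    -- A conflict inside `L` would refute any large truncation containing it and `x`: no undoubted
    -- stage contains `x`.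
    have hnd : ∀ A s, A ⊆ L → ¬ Doubted c (trunc L k) k A s := by
      rintro A s hA ⟨d, hd, hdA, hconf⟩
      refine hk (max s (max d x) + k + 1) (by omega) ⟨⟨d, by omega, fun y hy => ?_,
        hconf.mono (by omega)⟩, fun s' _ h => ?_⟩
      · have := lt_of_mem_bits hy
        exact mem_bits_trunc.2 ⟨by omega, hA (hdA hy)⟩
      · by_contra h'
        exact hx ⟨s', h (mem_bits_trunc.2 ⟨by omega, hxL⟩), h'⟩
    -- A different hypothesis here would be a conflict inside `L`.
    have hpe : ∀ i, 1 ≤ i → p (2 * k + i * (k + i)) = e := by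
      intro i hi
      by_contra hne
      obtain ⟨s₁, hs₁⟩ := Code.evaln_complete.1 he
      obtain ⟨s₂, hs₂⟩ := Code.evaln_complete.1 (hpn i)
      have h₁ := Code.evaln_mono
        (show s₁ ≤ s₁ + s₂ + trunc L (k + i) + (2 * k + i * (k + i)) by omega) hs₁
      have h₂ := Code.evaln_mono
        (show s₂ ≤ s₁ + s₂ + trunc L (k + i) + (2 * k + i * (k + i)) by omega) hs₂
      refine hnd L (s₁ + s₂ + trunc L (k + i) + (2 * k + i * (k + i))) subset_rfl
        ⟨trunc L (k + i), by omega, bits_trunc_subset _ _, bits_trunc_mono L (by omega),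
          2 * k + i * (k + i), by omega, by omega,
          (trunc_lt L _).trans_le (Nat.pow_le_pow_right (by norm_num) ?_), ?_⟩
      · rw [Nat.add_sub_cancel_left]
        exact Nat.le_mul_of_pos_left _ hi
      · rw [Option.mem_def.1 h₁, Option.mem_def.1 h₂]
        simpa using fun h => hne h.symm
    have hWe : W e = L := by
      have h := hn₀ (2 * k + (n₀ + 1) * (k + (n₀ + 1))) (by nlinarith)
      rw [hpe _ (by omega)] at h
      rw [h.1, h.2, hTL]
    have hall : ∀ m, ∃ s, ∀ y < m, y ∈ L → y ∈ enumerated c (trunc L k) k s := by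
      intro m
      induction m with
      | zero => exact ⟨0, by simp⟩
      | succ m ih =>
        obtain ⟨s, hs⟩ := ih
        by_cases hm : m ∈ L
        · obtain ⟨v, hv⟩ := Part.dom_iff_mem.1 (show m ∈ W e from hWe ▸ hm)
          obtain ⟨s₁, hs₁⟩ := Code.evaln_complete.1 he
          obtain ⟨s₂, hs₂⟩ := Code.evaln_complete.1 hv
          refine ⟨s + s₁ + s₂, fun y hy hyL => ?_⟩
          rcases Nat.lt_succ_iff_lt_or_eq.1 hy with hy | rfl
          · exact enumerated_mono (by omega) (hs y hy hyL)
          · exact mem_enumerated.2 ⟨e, Code.evaln_mono (by omega) hs₁, v,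
              Code.evaln_mono (by omega) hs₂⟩
        · refine ⟨s, fun y hy hyL => ?_⟩
          rcases Nat.lt_succ_iff_lt_or_eq.1 hy with hy | rfl
          · exact hs y hy hyL
          · exact absurd hyL hm
    obtain ⟨s, hs⟩ := hall (k + x + 1)
    refine hx ⟨s + x + 1, ?_, hnd _ _ ?_⟩
    · rcases lt_or_ge x k with hxk | hxk
      · exact Or.inl (mem_bits_trunc.2 ⟨hxk, hxL⟩)
      · refine Or.inr ⟨hxk, by omega, fun y hy => ?_, ?_⟩
        · obtain ⟨h₁, h₂⟩ := mem_bits_trunc.1 hy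
          exact enumerated_mono (by omega) (hs y (by omega) h₂)
        · exact enumerated_mono (by omega) (hs x (by omega) hxL)
    · rintro y (hy | ⟨-, -, -, hy⟩)
      · exact bits_trunc_subset _ _ hy
      · exact hWe ▸ henum _ hy

/-- Once all elements of `L` below the final cut-off have appeared, the state is constant, whatever
the order of the text. -/
theorem Learns.ex_of_state (hL : Learns c L) {q : ℕ → ℕ}
    (hq : ∀ b k, W (q (Nat.pair b k)) = hypSet c b k) {T : Text} (hT : T.content = L) :
    Ex (fun i => q (state c (T.code i) i)) T := by
  obtain ⟨k, hk, hk'⟩ := hL.exists_cut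
  have hcodeL : ∀ n, bits (T.code n) ⊆ L := fun n x hx => by
    obtain ⟨i, -, hi⟩ := mem_bits_code.1 hx
    exact hT ▸ ⟨i, hi⟩
  have hall : ∀ m, ∃ n, ∀ y < m, y ∈ L → y ∈ bits (T.code n) := by
    intro m
    induction m with
    | zero => exact ⟨0, by simp⟩
    | succ m ih =>
      obtain ⟨n, hn⟩ := ih
      by_cases hm : m ∈ L
      · obtain ⟨i, hi⟩ : m ∈ T.content := hT ▸ hm
        refine ⟨n + i + 1, fun y hy hyL => ?_⟩
        rcases Nat.lt_succ_iff_lt_or_eq.1 hy with hy | rfl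
        · exact bits_code_mono T (by omega) (hn y hy hyL)
        · exact mem_bits_code.2 ⟨i, by omega, hi⟩
      · refine ⟨n, fun y hy hyL => ?_⟩
        rcases Nat.lt_succ_iff_lt_or_eq.1 hy with hy | rfl
        · exact hn y hy hyL
        · exact absurd hyL hm
  obtain ⟨n, hn⟩ := hall k
  have hstate : ∀ m, n + k ≤ m → state c (T.code m) m = Nat.pair (trunc L k) k := by
    intro m hm
    have hmod : T.code m % 2 ^ k = trunc L k := by
      rw [← trunc_mod L le_rfl]
      refine mod_two_pow_congr fun x hx => ⟨fun h => mem_bits_trunc.2 ⟨hx, hcodeL m h⟩, fun h => ?_⟩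
      exact bits_code_mono T (by omega) (hn x hx (mem_bits_trunc.1 h).2)
    have hcut : cut c (T.code m) m = k :=
      cut_trunc_eq (by omega) hk hmod (hcodeL m) fun s hs _ => hk' s hs
    rw [state, hcut, hmod]
  refine ⟨n + k, fun m hm => ?_⟩
  simp only [hstate m hm, hstate (n + k) le_rfl, hq, hL.hypSet_eq hk', hT, and_self]

end Convergence

/-! ### The two directions of the equivalence. -/

/-- A witness-based learner that identifies the content of a text is target-cautious on it. -/
theorem Wb.cautTar {p : ℕ → ℕ} {T : Text} (hwb : Wb p T) (hex : Ex p T) : CautTar p T := by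
  intro n hn
  obtain ⟨n₀, hn₀⟩ := hex
  obtain ⟨h₁, h₂⟩ := hn₀ (max n n₀) (le_max_right _ _)
  have hne : p n ≠ p (max n n₀) := by
    intro h
    rw [h, h₁, h₂] at hn
    exact hn.ne rfl
  obtain ⟨x, ⟨-, hx⟩, hx'⟩ := hwb n (max n n₀) ⟨_, le_max_left _ _, le_rfl, hne⟩
  rw [h₁, h₂] at hx
  exact hx' (hn.subset hx)

/-- Every target-cautious explanatory learner can be replaced by a total computable one that
is witness-based on all texts. -/
theorem exists_total_wb {h : ℕ →. ℕ} (hh : Nat.Partrec h) :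
    ∃ f : ℕ → ℕ, Computable f ∧ (∀ T, Meets Wb (psdOp f T) T) ∧
      TxtPsd (Both CautTar Ex) h ⊆ TxtPsd (Both Wb Ex) f := by
  obtain ⟨c, rfl⟩ := Code.exists_code.1 hh
  obtain ⟨q, hqc, hq⟩ := exists_index_hypSet c
  have hd : Primrec fun n : ℕ => n.unpair.1 := Primrec.fst.comp Primrec.unpair
  have hcut := primrec_cut c hd (Primrec.snd.comp Primrec.unpair)
  have hop : ∀ T i, psdOp (fun n => q (state c n.unpair.1 n.unpair.2) : ℕ → ℕ) T i =
      Part.some (q (state c (T.code i) i)) := fun T i => by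
    simp [psdOp, psdCode_init]
  refine ⟨fun n => q (state c n.unpair.1 n.unpair.2),
    hqc.comp (Primrec₂.natPair.comp (primrec_mod_two_pow hd hcut) hcut).to_comp,
    fun T => ⟨_, hop T, wb_of_state hq T⟩, fun L hL T hT => ?_⟩
  refine ⟨_, hop T, wb_of_state hq T, Learns.ex_of_state (L := L) (fun T hT => ?_) hq hT⟩
  obtain ⟨p, hp, hp'⟩ := hL T hT
  refine ⟨p, fun i => ?_, hp'⟩
  have := hp i
  rw [psdOp, psdCode_init] at this
  rw [this]
  exact Part.mem_some _

end InductiveInference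

theorem mainTheorem3 (I : Set (ℕ →. ℕ)) (hI : InductiveInference.IsTotalMonoid I)
    (S : Set (Set ℕ)) (hS : ∀ A ∈ S, ∀ B, B ⊆ A → B ∈ S) (𝓛 : Set (Set ℕ)) :
    (∃ h ∈ I,
      𝓛 ⊆ InductiveInference.TxtPsd
        (InductiveInference.Both InductiveInference.Wb InductiveInference.Ex) h ∧
      InductiveInference.PsdOn InductiveInference.Wb h (InductiveInference.textsOfClass S)) ↔
    (∃ h ∈ I,
      𝓛 ⊆ InductiveInference.TxtPsd
        (InductiveInference.Both InductiveInference.CautTar InductiveInference.Ex) h ∧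
      InductiveInference.PsdOn InductiveInference.NoRestriction h
        (InductiveInference.textsOfClass S)) := by
  open InductiveInference in
  constructor
  · rintro ⟨h, hI', hL, hS'⟩
    refine ⟨h, hI', fun L hL' T hT => ?_, fun T hT => ?_⟩
    · obtain ⟨p, hp, hwb, hex⟩ := hL hL' T hT
      exact ⟨p, hp, hwb.cautTar hex, hex⟩
    · obtain ⟨p, hp, -⟩ := hS' T hT
      exact ⟨p, hp, trivial⟩
  · rintro ⟨h, hI', hL, -⟩
    obtain ⟨f, hf, hwb, hsub⟩ := exists_total_wb (hI.partrec h hI')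
    exact ⟨f, hI.total_mem f hf, hL.trans hsub, fun T _ => hwb T⟩
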